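/- Let $p$ be a prime, $q=p^2$, and let $\mathcal{E}_0/\mathbb{F}_p$ be an ordinary elliptic curve with an endomorphism $\phi_0$ generating a quadratic ring $\mathbb{Z}[\phi_0]$ (a GLV curve); let $\pi_0$ be the $p$-power Frobenius endomorphism of $\mathcal{E}_0$. Let $\mathcal{E}'/\mathbb{F}_{q}$ be the quadratic twist of $\mathcal{E}_0\otimes\mathbb{F}_{q}$ with twisting isomorphism $\tau$ over $\overline{\mathbb{F}}_p$; that is, the conjugate of $\tau$ by the $q$-power Frobenius automorphism of $\overline{\mathbb{F}}_p$ is $-\tau$. Put $\phi=\tau\phi_0\tau^{-1}$ (the GLV endomorphism of $\mathcal{E}'$) and $\psi=\tau\pi_0\tau^{-1}$ (the GLS endomorphism of $\mathcal{E}'$). Write $T^2-t_\phi T+n_\phi$ for the minimal polynomial of $\phi$ over $\mathbb{Z}$, and assume $\mathbb{Z}[\psi]\subset\mathbb{Z}[\phi]$, so that $\psi=c\phi+b$ with $b,c\in\mathbb{Z}$. Let $\mathcal{G}\subset\mathcal{E}'(\mathbb{F}_{q})$ be a cyclic subgroup of order $N$ with $\phi(\mathcal{G})\subset\mathcal{G}$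 and $\psi(\mathcal{G})\subset\mathcal{G}$. Let $\lambda_\phi,\lambda_\psi,\lambda_{\phi\psi}$ be integers such that $\phi,\psi,\phi\psi$ act on $\mathcal{G}$ as multiplication by $\lambda_\phi,\lambda_\psi,\lambda_{\phi\psi}$ respectively, and let $$\mathcal{L}=\{(z_1,z_2,z_3,z_4)\in\mathbb{Z}^4 : z_1+z_2\lambda_\phi+z_3\lambda_\psi+z_4\lambda_{\phi\psi}\equiv 0 \pmod N\}.$$ Then $\lambda_\psi^2\equiv-1\pmod N$, and the vectors $$\mathbf{b}_1=(1,0,b,c),\quad \mathbf{b}_2=(0,1,-c\,n_\phi,\,c\,t_\phi+b),\quad \mathbf{b}_3=(-b,-c,1,0),\quad \mathbf{b}_4=(c\,n_\phi,\,-c\,t_\phi-b,\,0,\,1)$$ lie in $\mathcal{L}$ and generate a sublattice of determinant $\#\mathcal{E}'(\mathbb{F}_{q})$, i.e. the absolute value of the determinant of the $4\times 4$ matrix with rows $\mathbf{b}_1,\dots,\mathbf{b}_4$ equals $\#\mathcal{E}'(\mathbb{F}_{q})$. If $\mathcal{G}=\mathcal{E}'(\mathbb{F}_{q})$, then $\mathbf{b}_1,\mathbf{b}_2,\mathbf{b}_3,\mathbf{b}_4$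 form a basis of $\mathcal{L}$. -/

import Mathlib

namespace EndoDecomp

open WeierstrassCurve

/-- The group `E(Ω)` of `Ω`-points of a curve `E` over a field `F`, for an extension `Ω` of `F`. -/
abbrev Pts {F : Type*} [Field F] (E : WeierstrassCurve F) (Ω : Type*) [Field Ω] [Algebra F Ω] :
    Type _ :=
  Affine.Point (E.baseChange Ω)

/-- The point `P` is the affine point with coordinates `(x, y)`. -/
def HasCoords {Ω : Type*} [Field Ω] {V : Affine Ω} (P : V.Point) (x y : Ω) : Prop :=
  ∃ h : V.Nonsingular x y, P = Affine.Point.some x y h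

/-- An endomorphism of an elliptic curve over an algebraically closed field `Ω`: a homomorphism
of the group of `Ω`-points that is zero or is given, on a nonempty Zariski-open set of affine
points, by rational functions `(f / h, g / h)` of the coordinates. -/
def IsAlgebraicEnd {Ω : Type*} [Field Ω] [DecidableEq Ω] {V : Affine Ω}
    (α : AddMonoid.End V.Point) : Prop :=
  α = 0 ∨ ∃ f g h : Polynomial (Polynomial Ω),
    (∃ x y : Ω, V.Nonsingular x y ∧ h.evalEval x y ≠ 0) ∧
    ∀ (P : V.Point) (x y : Ω), HasCoords P x y → h.evalEval x y ≠ 0 →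
      HasCoords (α P) (f.evalEval x y / h.evalEval x y) (g.evalEval x y / h.evalEval x y)

/-- An elliptic curve over an algebraically closed field of characteristic `p` is ordinary if it
has a point of order `p`. -/
def IsOrdinary {Ω : Type*} [Field Ω] [DecidableEq Ω] (p : ℕ) (V : Affine Ω) : Prop :=
  ∃ P : V.Point, P ≠ 0 ∧ p • P = 0

/-- The `#F`-power Frobenius endomorphism `(x, y) ↦ (x ^ #F, y ^ #F)` on the `Ω`-points of a
curve `E` over the finite field `F`. -/
noncomputable def frob {F : Type*} [Field F] [Fintype F] (Ω : Type*) [Field Ω] [DecidableEq Ω]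
    [Algebra F Ω] (E : WeierstrassCurve F) : AddMonoid.End (Pts E Ω) :=
  Affine.Point.map (FiniteField.frobeniusAlgHom F Ω)

/-- The subgroup `E(F)` of `E(Ω)`. -/
noncomputable def rationalPoints {F : Type*} [Field F] [DecidableEq F] (Ω : Type*) [Field Ω]
    [DecidableEq Ω] [Algebra F Ω] (E : WeierstrassCurve F) : AddSubgroup (Pts E Ω) :=
  (Affine.Point.baseChange F Ω : Pts E F →+ Pts E Ω).range

/-- `τ : E₀ ⊗ Ω → E'` is an isomorphism of Weierstrass curves over `Ω` that makes `E'`, a curve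
over the finite field `k`, a quadratic twist of `E₀ ⊗ k`: the conjugate of `τ` by the `#k`-power
map of `Ω`, which raises the coefficients of `τ` to the power `#k`, is `-τ`. -/
def IsQuadraticTwist {F k Ω : Type*} [Field F] [Field k] [Fintype k] [Field Ω] [DecidableEq Ω]
    [Algebra F Ω] [Algebra k Ω] (E₀ : WeierstrassCurve F) (E' : WeierstrassCurve k)
    (τ : Pts E₀ Ω ≃+ Pts E' Ω) : Prop :=
  ∃ u r s t : Ω, u ≠ 0 ∧
    (∀ (P : Pts E₀ Ω) (x y : Ω), HasCoords P x y →
      HasCoords (τ P) (u ^ 2 * x + r) (u ^ 3 * y + s * u ^ 2 * x + t)) ∧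
    ∀ (P : Pts E₀ Ω) (x y : Ω), HasCoords P x y →
      HasCoords (-τ P) ((u ^ Fintype.card k) ^ 2 * x + r ^ Fintype.card k)
        ((u ^ Fintype.card k) ^ 3 * y
          + s ^ Fintype.card k * (u ^ Fintype.card k) ^ 2 * x + t ^ Fintype.card k)

/-- The endomorphism `τ α τ⁻¹`. -/
def conj {A B : Type*} [AddCommGroup A] [AddCommGroup B] (τ : A ≃+ B) (α : AddMonoid.End A) :
    AddMonoid.End B :=
  (τ.toAddMonoidHom.comp α).comp τ.symm.toAddMonoidHom

/-- `α` is not an integer and generates a quadratic ring `ℤ[α]`: its minimal polynomial over `ℤ`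
has degree two. -/
def IsQuadratic {A : Type*} [AddCommGroup A] (α : AddMonoid.End A) : Prop :=
  (minpoly ℤ α).natDegree = 2

/-- For quadratic `α` with minimal polynomial `T ^ 2 - t T + n`, the trace `t`. -/
noncomputable def endTrace {A : Type*} [AddCommGroup A] (α : AddMonoid.End A) : ℤ :=
  -(minpoly ℤ α).coeff 1

/-- For quadratic `α` with minimal polynomial `T ^ 2 - t T + n`, the norm `n`. -/
noncomputable def endNorm {A : Type*} [AddCommGroup A] (α : AddMonoid.End A) : ℤ :=
  (minpoly ℤ α).coeff 0

/-- `α` acts on the subgroup `G` as multiplication by the integer `l`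
(in particular `α` maps `G` into `G`). -/
def IsEigenvalue {A : Type*} [AddCommGroup A] (G : AddSubgroup A) (α : AddMonoid.End A)
    (l : ℤ) : Prop :=
  ∀ P ∈ G, α P = l • P

/-- The homomorphism `D : ℤ ^ r → ℤ / N`, `(a₁, …, a_r) ↦ a₁ l₁ + ⋯ + a_r l_r`. -/
def decomp (N : ℕ) {r : ℕ} (l : Fin r → ℤ) : (Fin r → ℤ) →ₗ[ℤ] ZMod N :=
  Fintype.linearCombination ℤ (fun i => (l i : ZMod N))

/-- The lattice `ker D` of decompositions of zero. -/
def decompLattice (N : ℕ) {r : ℕ} (l : Fin r → ℤ) : Submodule ℤ (Fin r → ℤ) :=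
  LinearMap.ker (decomp N l)

end EndoDecomp

/-!
The point is the equality of `#E'(𝔽_q)` with the norm of `1 + ψ ^ 2` in the quadratic ring `ℤ[φ]`:
the determinant of the four vectors is that norm, and the vectors themselves merely express that
`1 + ψ ^ 2` kills `E'(𝔽_q)` and that `ψ = c φ + b`.

The twisting isomorphism `τ` carries the square `π ^ 2` of the Frobenius endomorphism of `E₀` to the
negative of the `q`-power Frobenius endomorphism of `E'`, so that `E'(𝔽_q)` is the kernel of
`1 + ψ ^ 2`, and corresponds to that of `1 + π ^ 2` (`IsQuadraticTwist.mem_rationalPoints_iff`).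
The equation `φ ^ 2 = t φ - n` gives an equation `π ^ 2 = T π - M` with `T = c t + 2 b` and
`M = b ^ 2 + b c t + c ^ 2 n`; it remains to see that `M = p` and that the kernel of `1 + π ^ 2` has
`(1 - M) ^ 2 + T ^ 2` elements.

Both follow from the theory of the degree, which is developed through `x`-coordinates. An
endomorphism `α` induces a morphism of the projective line, and its degree is `deg α` (`HasDegree`).
The Kummer map `{x(P), x(Q)} ↦ {x(P + Q), x(P - Q)}` is given by quadratic forms without base points
(`WeierstrassCurve.addSubMap`), whence the parallelogram law
`deg (α + β) + deg (α - β) = 2 deg α + 2 deg β` (`HasDegree.parallelogram`). So the degree is a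
quadratic form `i ^ 2 + s i j + p j ^ 2` on the elements `i + j π` (`IsPowerMap.hasDegree_add`).
Computing the degrees of `π ^ 2` and `(π - 1) π` in two ways gives `M = p` and `T = s`, or
`π ^ 2 = p`, which is impossible on an ordinary curve as `π` is injective
(`IsPowerMap.card_ker_mul_self_add_one`).

The kernel of an endomorphism has at most as many elements as its degree (`HasDegree.card_ker_le`).
For `π ^ 2 + 1` and `π ^ 2 - 1` the degrees add up to `2 q + 2`, and the orders of the kernels to at
least as much, because every point of the projective line over `𝔽_q` is the `x`-coordinate of a pair
`± P` that `π ^ 2` maps to itself up to sign (`IsPowerMap.le_card_fixed_add`). Hence the bounds are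
equalities.

Finally, the lattice `L` has index `N`, so when `N = #E'(𝔽_q)` the vectors, of determinant `N`,
form a basis of it (`span_eq_of_abs_det_eq_index`).
-/

/-! ### The Kummer map -/

namespace WeierstrassCurve.Affine.Point

variable {K : Type*} [Field K] [DecidableEq K] {V : Affine K}

open MvPolynomial in
/-- The map `WeierstrassCurve.addSubMap` sends the unordered pair `{x(P), x(Q)}` to
`{x(P + Q), x(P - Q)}`. -/
lemma eval_addSubMap_sym2x [V.IsElliptic] (P Q : V.Point) :
    ∃ κ : K, κ ≠ 0 ∧ ∀ i, (V.addSubMap i).eval (P.sym2x Q) =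
      κ * (P + Q).sym2x (P - Q) i := by
  -- the case `P = Q`, to which `P = -Q` reduces by symmetry
  have hdbl (P : V.Point) : ∃ κ : K, κ ≠ 0 ∧ ∀ i, (V.addSubMap i).eval (P.sym2x P) =
      κ * (P + P).sym2x 0 i := by
    match P with
    | 0 => exact ⟨1, one_ne_zero, fun i ↦ by fin_cases i <;> simp [addSubMap]⟩
    | some x y h =>
      have heq := (V.equation_iff x y).1 h.1
      by_cases hy : y = V.negY x y
      -- when `2 P = 0`, the scalar is nonzero because `addSubMap` has no base points
      · have hne := V.addSubMap_ne_zero ((some x y h).sym2x_ne_zero (some x y h))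
        rw [add_self_of_Y_eq hy]
        rw [negY] at hy
        have h1 : (V.addSubMap 1).eval ((some x y h).sym2x (some x y h)) = 0 := by
          simp only [addSubMap, sym2x_some_some, WeierstrassCurve.b₂, WeierstrassCurve.b₄,
            WeierstrassCurve.b₆]
          simp
          linear_combination (-4) * heq + (2 * y + V.a₁ * x + V.a₃) * hy
        have h2 : (V.addSubMap 2).eval ((some x y h).sym2x (some x y h)) = 0 := by
          simp [addSubMap]; ring
        refine ⟨(V.addSubMap 0).eval ((some x y h).sym2x (some x y h)), fun h0 ↦ hne ?_, ?_⟩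
        · funext i
          fin_cases i
          exacts [h0, h1, h2]
        · intro i
          fin_cases i
          · simp
          · simpa using h1
          · simpa using h2
      · have hψ : 2 * y + V.a₁ * x + V.a₃ ≠ 0 := fun h0 ↦ hy (by rw [negY]; linear_combination h0)
        refine ⟨(2 * y + V.a₁ * x + V.a₃) ^ 2, pow_ne_zero 2 hψ, ?_⟩
        rw [add_self_of_Y_ne hy, sym2x_some_zero]
        have hd : y - V.negY x y = 2 * y + V.a₁ * x + V.a₃ := by rw [negY]; ring
        have hl : V.slope x x y y * (2 * y + V.a₁ * x + V.a₃) =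
            3 * x ^ 2 + 2 * V.a₂ * x + V.a₄ - V.a₁ * y := by
          rw [slope_of_Y_ne rfl hy, hd, div_mul_cancel₀ _ hψ]
        generalize V.slope x x y y = l at hl
        have h6 : V.a₆ = y ^ 2 + V.a₁ * x * y + V.a₃ * y - (x ^ 3 + V.a₂ * x ^ 2 + V.a₄ * x) := by
          linear_combination -heq
        intro i
        fin_cases i
        · simp [addSubMap, addX, WeierstrassCurve.b₂, WeierstrassCurve.b₄, WeierstrassCurve.b₆,
            WeierstrassCurve.b₈]
          rw [h6]
          linear_combination (-(l * (2 * y + V.a₁ * x + V.a₃)) -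
            (3 * x ^ 2 + 2 * V.a₂ * x + V.a₄ - V.a₁ * y) -
            V.a₁ * (2 * y + V.a₁ * x + V.a₃)) * hl
        · simp [addSubMap, WeierstrassCurve.b₂, WeierstrassCurve.b₄, WeierstrassCurve.b₆]
          linear_combination (-4) * heq
        · simp [addSubMap]; ring
  match P, Q with
  | 0, Q =>
    refine ⟨1, one_ne_zero, fun i ↦ ?_⟩
    rw [zero_add, zero_sub, sym2x_neg_right]
    match Q with
    | 0 => fin_cases i <;> simp [addSubMap]
    | some x y h => fin_cases i <;> simp [addSubMap] <;> ring
  | P, 0 =>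
    refine ⟨1, one_ne_zero, fun i ↦ ?_⟩
    rw [add_zero, sub_zero]
    match P with
    | 0 => fin_cases i <;> simp [addSubMap]
    | some x y h => fin_cases i <;> simp [addSubMap] <;> ring
  | some x₁ y₁ h₁, some x₂ y₂ h₂ =>
    by_cases hx : x₁ = x₂
    · rcases X_eq_iff.1 hx with hPQ | hPQ
      · rw [← hPQ, sub_self]
        exact hdbl _
      · have : some x₂ y₂ h₂ = -some x₁ y₁ h₁ := by rw [hPQ, neg_neg]
        rw [this, sym2x_neg_right, add_neg_cancel, sub_neg_eq_add, sym2x_comm 0]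
        exact hdbl _
    · have hx' := sub_ne_zero.2 hx
      refine ⟨(x₁ - x₂) ^ 2, pow_ne_zero 2 hx', ?_⟩
      have e₁ := (V.equation_iff x₁ y₁).1 h₁.1
      have e₂ := (V.equation_iff x₂ y₂).1 h₂.1
      rw [sub_eq_add_neg (some x₁ y₁ h₁), neg_some, add_of_X_ne hx, add_of_X_ne hx,
        sym2x_some_some, sym2x_some_some]
      simp only [addX, slope_of_X_ne hx, negY]
      have h6 : V.a₆ = y₁ ^ 2 + V.a₁ * x₁ * y₁ + V.a₃ * y₁ -
          (x₁ ^ 3 + V.a₂ * x₁ ^ 2 + V.a₄ * x₁) := by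
        linear_combination -e₁
      have h4 : V.a₄ = (y₁ ^ 2 + V.a₁ * x₁ * y₁ + V.a₃ * y₁ - (x₁ ^ 3 + V.a₂ * x₁ ^ 2) -
          (y₂ ^ 2 + V.a₁ * x₂ * y₂ + V.a₃ * y₂ - (x₂ ^ 3 + V.a₂ * x₂ ^ 2))) / (x₁ - x₂) := by
        rw [eq_div_iff hx']
        linear_combination e₂ - e₁
      intro i
      fin_cases i
      · simp [addSubMap, WeierstrassCurve.b₂, WeierstrassCurve.b₄, WeierstrassCurve.b₆,
            WeierstrassCurve.b₈]
        rw [h6, h4]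
        field_simp
        ring
      · simp [addSubMap, WeierstrassCurve.b₂, WeierstrassCurve.b₄, WeierstrassCurve.b₆]
        rw [h6, h4]
        field_simp
        ring
      · simp [addSubMap]; ring

end WeierstrassCurve.Affine.Point

namespace EndoDecomp

/-! ### Projective vectors of polynomials -/

section

open Polynomial

variable {K : Type*} [Field K]

/-- The polynomials `v i` have no common zero on the affine line, and as forms of degree `n` they
have none at infinity either; that is, `v` defines a morphism of degree `n` from the projective
line to a projective space. -/
structure IsPrimitiveOfDegree {ι : Type*} (v : ι → K[X]) (n : ℕ) : Prop where
  natDegree_le : ∀ i, (v i).natDegree ≤ n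
  exists_coeff_ne_zero : ∃ i, (v i).coeff n ≠ 0
  exists_eval_ne_zero : ∀ x, ∃ i, (v i).eval x ≠ 0

namespace IsPrimitiveOfDegree

/-- Polynomials without a common zero generate the unit ideal. -/
lemma exists_sum_eq_one [IsAlgClosed K] {ι : Type*} [Fintype ι] {v : ι → K[X]} {n : ℕ}
    (hv : IsPrimitiveOfDegree v n) : ∃ a : ι → K[X], ∑ i, a i * v i = 1 := by
  set I := Ideal.span (Set.range v) with hI
  obtain ⟨g, hg⟩ := (IsPrincipalIdealRing.principal I).principal
  have hdvd (i : ι) : g ∣ v i := by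
    rw [← Ideal.mem_span_singleton, ← Ideal.submodule_span_eq, ← hg]
    exact Ideal.subset_span ⟨i, rfl⟩
  have hg1 : IsUnit g := by
    by_contra hu
    have h0 : ∃ x, g.eval x = 0 := by
      by_cases hg0 : g = 0
      · exact ⟨0, by simp [hg0]⟩
      · exact IsAlgClosed.exists_root g fun hd ↦ hu (isUnit_iff_degree_eq_zero.2 hd)
    obtain ⟨x, hx⟩ := h0
    obtain ⟨i, hi⟩ := hv.exists_eval_ne_zero x
    obtain ⟨w, hw⟩ := hdvd i
    exact hi (by rw [hw, eval_mul, hx, zero_mul])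
  have h1 : (1 : K[X]) ∈ I := by
    rw [hg, Ideal.submodule_span_eq, Ideal.span_singleton_eq_top.2 hg1]
    trivial
  exact (Ideal.mem_span_range_iff_exists_fun).1 h1

lemma exists_eq_mul [IsAlgClosed K] {ι : Type*} [Fintype ι] {v w : ι → K[X]} {n : ℕ}
    (hv : IsPrimitiveOfDegree v n) (h : ∀ i j, v i * w j = v j * w i) :
    ∃ g, ∀ i, w i = g * v i := by
  obtain ⟨a, ha⟩ := hv.exists_sum_eq_one
  refine ⟨∑ j, a j * w j, fun i ↦ ?_⟩
  rw [← one_mul (w i), ← ha, Finset.sum_mul, Finset.sum_mul]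
  exact Finset.sum_congr rfl fun j _ ↦ by rw [mul_assoc, ← h i j]; ring

/-- Two proportional primitive vectors have the same degree. -/
lemma degree_unique [IsAlgClosed K] {ι : Type*} [Fintype ι] {v w : ι → K[X]} {n m : ℕ}
    (hv : IsPrimitiveOfDegree v n) (hw : IsPrimitiveOfDegree w m)
    (h : ∀ i j, v i * w j = v j * w i) : n = m := by
  wlog hlt : n < m generalizing v w n m
  · rcases (not_lt.1 hlt).eq_or_lt with h' | h'
    · exact h'.symm
    · exact (this hw hv (fun i j ↦ by rw [mul_comm, h j i, mul_comm]) h').symm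
  exfalso
  obtain ⟨f, hf⟩ := hv.exists_eq_mul h
  obtain ⟨g, hg⟩ := hw.exists_eq_mul (fun i j ↦ by rw [mul_comm, h j i, mul_comm])
  obtain ⟨i, hi⟩ := hw.exists_coeff_ne_zero
  have hwi : w i ≠ 0 := fun h0 ↦ hi (by simp [h0])
  have hfg : f * g = 1 := by
    apply mul_right_cancel₀ hwi
    rw [mul_assoc, ← hg, ← hf, one_mul]
  have hfu : IsUnit f := IsUnit.of_mul_eq_one g hfg
  obtain ⟨c, -, rfl⟩ := Polynomial.isUnit_iff.1 hfu
  apply hi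
  rw [hf, coeff_C_mul, coeff_eq_zero_of_natDegree_lt ((hv.natDegree_le i).trans_lt hlt), mul_zero]

lemma of_isCoprime {A B : K[X]} (h : IsCoprime A B) :
    IsPrimitiveOfDegree ![A, B] (max A.natDegree B.natDegree) := by
  refine ⟨fun i ↦ by fin_cases i <;> simp, ?_, fun x ↦ ?_⟩
  · by_contra! h0
    have hA := h0 0
    have hB := h0 1
    simp only [Matrix.cons_val_zero, Matrix.cons_val_one] at hA hB
    rcases le_total A.natDegree B.natDegree with hle | hle
    · rw [max_eq_right hle, coeff_natDegree, leadingCoeff_eq_zero] at hB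
      subst hB
      have hA0 : A.natDegree = 0 := by simpa using hle
      rw [hA0, natDegree_zero, max_self, ← hA0, coeff_natDegree, leadingCoeff_eq_zero] at hA
      subst hA
      exact not_isCoprime_zero_zero h
    · rw [max_eq_left hle, coeff_natDegree, leadingCoeff_eq_zero] at hA
      subst hA
      have hB0 : B.natDegree = 0 := by simpa using hle
      rw [hB0, natDegree_zero, max_self, ← hB0, coeff_natDegree, leadingCoeff_eq_zero] at hB
      subst hB
      exact not_isCoprime_zero_zero h
  · by_contra! h0
    have hA := h0 0
    have hB := h0 1
    simp only [Matrix.cons_val_zero, Matrix.cons_val_one] at hA hB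
    obtain ⟨a, b, hab⟩ := h
    have := congrArg (eval x) hab
    simp [hA, hB] at this

/-- A pair of polynomials that are not both zero is proportional to a primitive pair. -/
lemma exists_of_ne_zero {U V : K[X]} (h : U ≠ 0 ∨ V ≠ 0) :
    ∃ (g A B : K[X]) (n : ℕ), g ≠ 0 ∧ U = g * A ∧ V = g * B ∧ IsPrimitiveOfDegree ![A, B] n := by
  classical
  have hg : EuclideanDomain.gcd U V ≠ 0 := by
    rw [Ne, EuclideanDomain.gcd_eq_zero_iff]
    tauto
  obtain ⟨A, hA⟩ := EuclideanDomain.gcd_dvd_left U V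
  obtain ⟨B, hB⟩ := EuclideanDomain.gcd_dvd_right U V
  refine ⟨_, A, B, _, hg, hA, hB, of_isCoprime ?_⟩
  refine ⟨EuclideanDomain.gcdA U V, EuclideanDomain.gcdB U V, mul_left_cancel₀ hg ?_⟩
  have := EuclideanDomain.gcd_eq_gcd_ab U V
  rw [mul_one]
  linear_combination -this - EuclideanDomain.gcdA U V * hA - EuclideanDomain.gcdB U V * hB

end IsPrimitiveOfDegree

/-- The polynomial version of `WeierstrassCurve.Affine.Point.sym2x`: the coordinates
`(x x' : x + x' : 1)` of an unordered pair of points of the projective line. -/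
noncomputable def symPair (v w : Fin 2 → K[X]) : Fin 3 → K[X] :=
  ![v 0 * w 0, v 0 * w 1 + v 1 * w 0, v 1 * w 1]

/-- The polynomials in `WeierstrassCurve.addSubMap`, evaluated at a vector of polynomials. -/
noncomputable def kummer (V : WeierstrassCurve K) (v : Fin 3 → K[X]) (i : Fin 3) : K[X] :=
  MvPolynomial.aeval v (V.addSubMap i)

lemma eval_kummer (V : WeierstrassCurve K) (v : Fin 3 → K[X]) (i : Fin 3) (x : K) :
    (kummer V v i).eval x = (V.addSubMap i).eval (fun j ↦ (v j).eval x) := by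
  rw [kummer, ← Polynomial.coe_aeval_eq_eval, ← AlgHom.comp_apply, MvPolynomial.comp_aeval,
    MvPolynomial.aeval_eq_eval]

lemma eval_symPair (v w : Fin 2 → K[X]) (x : K) (i : Fin 3) :
    (symPair v w i).eval x = ![(v 0).eval x * (w 0).eval x,
      (v 0).eval x * (w 1).eval x + (v 1).eval x * (w 0).eval x,
      (v 1).eval x * (w 1).eval x] i := by
  fin_cases i <;> simp [symPair]

lemma IsPrimitiveOfDegree.symPair {v w : Fin 2 → K[X]} {n m : ℕ} (hv : IsPrimitiveOfDegree v n)
    (hw : IsPrimitiveOfDegree w m) : IsPrimitiveOfDegree (symPair v w) (n + m) := by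
  have key (a b c d : K) (hab : a ≠ 0 ∨ b ≠ 0) (hcd : c ≠ 0 ∨ d ≠ 0) :
      ∃ i, (![a * c, a * d + b * c, b * d] : Fin 3 → K) i ≠ 0 := by
    by_contra! h
    have h0 := h 0
    have h1 := h 1
    have h2 := h 2
    simp only [Matrix.cons_val] at h0 h1 h2
    grind
  have hmul (i j : Fin 2) : (v i * w j).natDegree ≤ n + m :=
    natDegree_mul_le_of_le (hv.natDegree_le i) (hw.natDegree_le j)
  have hcoeff (i j : Fin 2) : (v i * w j).coeff (n + m) = (v i).coeff n * (w j).coeff m :=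
    coeff_mul_add_eq_of_natDegree_le (hv.natDegree_le i) (hw.natDegree_le j)
  refine ⟨fun i ↦ ?_, ?_, fun x ↦ ?_⟩
  · fin_cases i
    · exact hmul 0 0
    · exact natDegree_add_le_of_degree_le (hmul 0 1) (hmul 1 0)
    · exact hmul 1 1
  · obtain ⟨i, hi⟩ := key _ _ _ _ (Fin.exists_fin_two.1 hv.exists_coeff_ne_zero)
      (Fin.exists_fin_two.1 hw.exists_coeff_ne_zero)
    refine ⟨i, ?_⟩
    convert hi using 1
    fin_cases i <;> simp [EndoDecomp.symPair, hcoeff]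
  · obtain ⟨i, hi⟩ := key _ _ _ _ (Fin.exists_fin_two.1 (hv.exists_eval_ne_zero x))
      (Fin.exists_fin_two.1 (hw.exists_eval_ne_zero x))
    exact ⟨i, by rwa [eval_symPair]⟩

/-- The map `WeierstrassCurve.addSubMap` is a morphism of degree two of the projective plane, as
it has no base points when the curve is elliptic. -/
lemma IsPrimitiveOfDegree.kummer (V : WeierstrassCurve K) [V.IsElliptic] {v : Fin 3 → K[X]} {n : ℕ}
    (hv : IsPrimitiveOfDegree v n) : IsPrimitiveOfDegree (kummer V v) (n + n) := by
  have hmul (i j : Fin 3) : (v i * v j).natDegree ≤ n + n :=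
    natDegree_mul_le_of_le (hv.natDegree_le i) (hv.natDegree_le j)
  have hcmul (a : K) (i j : Fin 3) : (C a * (v i * v j)).natDegree ≤ n + n :=
    natDegree_C_mul_le _ _ |>.trans (hmul i j)
  have hcoeff (i j : Fin 3) : (v i * v j).coeff (n + n) = (v i).coeff n * (v j).coeff n :=
    coeff_mul_add_eq_of_natDegree_le (hv.natDegree_le i) (hv.natDegree_le j)
  have e0 : EndoDecomp.kummer V v 0 = v 0 * v 0 - C V.b₄ * (v 0 * v 2) - C V.b₆ * (v 1 * v 2)
      - C V.b₈ * (v 2 * v 2) := by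
    simp [EndoDecomp.kummer, WeierstrassCurve.addSubMap]; ring
  have e1 : EndoDecomp.kummer V v 1 = C 2 * (v 1 * v 0) + C V.b₂ * (v 0 * v 2)
      + C V.b₄ * (v 1 * v 2) + C V.b₆ * (v 2 * v 2) := by
    simp [EndoDecomp.kummer, WeierstrassCurve.addSubMap]; ring
  have e2 : EndoDecomp.kummer V v 2 = v 1 * v 1 - C 4 * (v 0 * v 2) := by
    simp [EndoDecomp.kummer, WeierstrassCurve.addSubMap]; ring
  have key (y : Fin 3 → K) (hy : ∃ i, y i ≠ 0) : ∃ i, (V.addSubMap i).eval y ≠ 0 :=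
    Function.ne_iff.1 (V.addSubMap_ne_zero (Function.ne_iff.2 hy))
  refine ⟨fun i ↦ ?_, ?_, fun x ↦ ?_⟩
  · fin_cases i
    · simp only [Fin.zero_eta, e0]
      exact (natDegree_sub_le_of_le (natDegree_sub_le_of_le (natDegree_sub_le_of_le (hmul ..)
        (hcmul ..)) (hcmul ..)) (hcmul ..)).trans (by simp)
    · simp only [Fin.mk_one, e1]
      exact natDegree_add_le_of_degree_le (natDegree_add_le_of_degree_le
        (natDegree_add_le_of_degree_le (hcmul ..) (hcmul ..)) (hcmul ..)) (hcmul ..)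
    · simp only [Fin.reduceFinMk, e2]
      exact (natDegree_sub_le_of_le (hmul ..) (hcmul ..)).trans (by simp)
  · obtain ⟨i, hi⟩ := key _ hv.exists_coeff_ne_zero
    refine ⟨i, ?_⟩
    convert hi using 1
    fin_cases i
    · simp only [Fin.zero_eta, e0, coeff_sub, coeff_C_mul, hcoeff]
      simp [WeierstrassCurve.addSubMap]; ring
    · simp only [Fin.mk_one, e1, coeff_add, coeff_C_mul, hcoeff]
      simp [WeierstrassCurve.addSubMap]; ring
    · simp only [Fin.reduceFinMk, e2, coeff_sub, coeff_C_mul, hcoeff]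
      simp [WeierstrassCurve.addSubMap]; ring
  · obtain ⟨i, hi⟩ := key _ (hv.exists_eval_ne_zero x)
    exact ⟨i, by rwa [eval_kummer]⟩

end

/-! ### The degree of an endomorphism -/

section

open Polynomial Filter WeierstrassCurve.Affine

section End

variable {A : Type*} [AddCommGroup A] (α β : AddMonoid.End A) (P : A)

lemma end_add_apply : (α + β) P = α P + β P := rfl

lemma end_sub_apply : (α - β) P = α P - β P := rfl

lemma end_neg_apply : (-α) P = -α P := rfl

lemma end_mul_apply : (α * β) P = α (β P) := rfl

lemma end_zsmul_apply (n : ℤ) : (n • α) P = n • α P := rfl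

end End

variable {K : Type*} [Field K] {V : WeierstrassCurve.Affine K}

lemma exists_nonsingular [IsAlgClosed K] [V.IsElliptic] (x : K) : ∃ y, V.Nonsingular x y := by
  have hd : (C (1 : K) * X ^ 2 + C (V.a₁ * x + V.a₃) * X +
      C (-(x ^ 3 + V.a₂ * x ^ 2 + V.a₄ * x + V.a₆))).degree ≠ 0 := by
    rw [degree_quadratic one_ne_zero]
    decide
  obtain ⟨y, hy⟩ := IsAlgClosed.exists_root _ hd
  refine ⟨y, V.equation_iff_nonsingular.1 ((V.equation_iff x y).2 ?_)⟩
  simp at hy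
  linear_combination hy

lemma eventually_eval_ne_zero {f : K[X]} (hf : f ≠ 0) : ∀ᶠ x in cofinite, f.eval x ≠ 0 := by
  simpa [eventually_cofinite] using! f.finite_setOfPred_isRoot hf

lemma eq_of_eventually_eval_eq [Infinite K] {f g : K[X]}
    (h : ∀ᶠ x in cofinite, f.eval x = g.eval x) : f = g :=
  eq_of_infinite_eval_eq f g (frequently_cofinite_iff_infinite.1 h.frequently)

/-- Only finitely many points are fixed by negation. -/
lemma eventually_two_mul_add_ne_zero [V.IsElliptic] :
    ∀ᶠ x in cofinite, ∀ y, V.Nonsingular x y → 2 * y + V.a₁ * x + V.a₃ ≠ 0 := by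
  set f : K[X] := C 4 * X ^ 3 + C V.b₂ * X ^ 2 + C (2 * V.b₄) * X + C V.b₆ with hf
  have hf0 : f ≠ 0 := by
    intro h0
    have h3 : f.coeff 3 = 4 := by simp [hf]
    have h2 : f.coeff 2 = V.b₂ := by simp [hf]
    have h1 : f.coeff 1 = 2 * V.b₄ := by simp [hf]
    have h00 : f.coeff 0 = V.b₆ := by simp [hf]
    rw [h0, coeff_zero] at h3 h2 h1 h00
    refine V.isUnit_Δ.ne_zero ?_
    rw [WeierstrassCurve.Δ, ← h2, ← h00]
    linear_combination 4 * V.b₄ ^ 2 * h1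
  filter_upwards [eventually_eval_ne_zero hf0] with x hx y hy h0
  apply hx
  have := (V.equation_iff x y).1 hy.1
  simp only [hf, WeierstrassCurve.b₂, WeierstrassCurve.b₄, WeierstrassCurve.b₆]
  simp
  linear_combination (-4) * this + (2 * y + V.a₁ * x + V.a₃) * h0

variable [DecidableEq K]

/-- The endomorphism `α` has degree `n`: the map of the projective line that it induces on
`x`-coordinates is, outside finitely many points, given by a pair of forms of degree `n` without a
common zero. The zero endomorphism has degree `0`. -/
def HasDegree (α : AddMonoid.End V.Point) (n : ℕ) : Prop :=
  ∃ v : Fin 2 → K[X], IsPrimitiveOfDegree v n ∧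
    ∀ᶠ x in cofinite, ∀ y (h : V.Nonsingular x y), ∃ κ : K, κ ≠ 0 ∧
      ∀ i, (v i).eval x = κ * (α (Point.some x y h)).xRep i

lemma hasDegree_one : HasDegree (1 : AddMonoid.End V.Point) 1 := by
  have h := IsPrimitiveOfDegree.of_isCoprime (isCoprime_one_right (x := (X : K[X])))
  refine ⟨![X, 1], by simpa using h, .of_forall fun x y h ↦ ⟨1, one_ne_zero, fun i ↦ ?_⟩⟩
  fin_cases i <;> simp

lemma hasDegree_zero : HasDegree (0 : AddMonoid.End V.Point) 0 := by
  have h := IsPrimitiveOfDegree.of_isCoprime (isCoprime_one_left (x := (0 : K[X])))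
  refine ⟨![1, 0], by simpa using h, .of_forall fun x y h ↦ ⟨1, one_ne_zero, fun i ↦ ?_⟩⟩
  fin_cases i <;> simp

lemma HasDegree.neg {α : AddMonoid.End V.Point} {n : ℕ} (h : HasDegree α n) :
    HasDegree (-α) n := by
  obtain ⟨v, hv, hx⟩ := h
  refine ⟨v, hv, ?_⟩
  filter_upwards [hx] with x hx y h
  simpa only [end_neg_apply, Point.xRep_neg] using hx y h

lemma exists_hasDegree_of_pair [IsAlgClosed K] [V.IsElliptic] {α : AddMonoid.End V.Point}
    (U : Fin 2 → K[X]) (h : ∀ᶠ x in cofinite, ∀ y (h : V.Nonsingular x y), ∃ κ : K, κ ≠ 0 ∧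
      ∀ i, (U i).eval x = κ * (α (Point.some x y h)).xRep i) : ∃ n, HasDegree α n := by
  have hU : U 0 ≠ 0 ∨ U 1 ≠ 0 := by
    obtain ⟨x, hx⟩ := h.exists
    obtain ⟨y, hy⟩ := exists_nonsingular (V := V) x
    obtain ⟨κ, hκ, hi⟩ := hx y hy
    by_contra! h0
    apply (α (Point.some x y hy)).xRep_ne_zero
    funext i
    have := hi i
    fin_cases i <;> simpa [h0, hκ] using this
  obtain ⟨g, A, B, n, hg, hA, hB, hn⟩ := IsPrimitiveOfDegree.exists_of_ne_zero hU
  refine ⟨n, ![A, B], hn, ?_⟩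
  filter_upwards [h, eventually_eval_ne_zero hg] with x hx hgx y hy
  obtain ⟨κ, hκ, hi⟩ := hx y hy
  refine ⟨κ / g.eval x, div_ne_zero hκ hgx, fun i ↦ ?_⟩
  rw [div_mul_eq_mul_div, eq_div_iff hgx, ← hi i]
  fin_cases i
  · simp [hA, mul_comm]
  · simp [hB, mul_comm]

/-- The values of the Kummer map on the `x`-coordinates of two endomorphisms. -/
lemma eventually_eval_kummer [V.IsElliptic] {α β : AddMonoid.End V.Point} {v w : Fin 2 → K[X]}
    (hv : ∀ᶠ x in cofinite, ∀ y (h : V.Nonsingular x y), ∃ κ : K, κ ≠ 0 ∧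
      ∀ i, (v i).eval x = κ * (α (Point.some x y h)).xRep i)
    (hw : ∀ᶠ x in cofinite, ∀ y (h : V.Nonsingular x y), ∃ κ : K, κ ≠ 0 ∧
      ∀ i, (w i).eval x = κ * (β (Point.some x y h)).xRep i) :
    ∀ᶠ x in cofinite, ∀ y (h : V.Nonsingular x y), ∃ κ : K, κ ≠ 0 ∧
      ∀ i, (kummer V (symPair v w) i).eval x =
        κ * ((α + β) (Point.some x y h)).sym2x ((α - β) (Point.some x y h)) i := by
  filter_upwards [hv, hw] with x hx hx' y h
  obtain ⟨κ, hκ, hi⟩ := hx y h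
  obtain ⟨κ', hκ', hi'⟩ := hx' y h
  obtain ⟨c, hc, hci⟩ := Point.eval_addSubMap_sym2x (α (Point.some x y h)) (β (Point.some x y h))
  refine ⟨(κ * κ') ^ 2 * c, mul_ne_zero (pow_ne_zero 2 (mul_ne_zero hκ hκ')) hc, fun i ↦ ?_⟩
  rw [end_add_apply, end_sub_apply, mul_assoc, ← hci i, eval_kummer]
  simp only [eval_symPair, hi, hi', Point.sym2x]
  fin_cases i <;> simp [WeierstrassCurve.addSubMap] <;> ring

/-- The degree satisfies the parallelogram law. -/
lemma HasDegree.parallelogram [IsAlgClosed K] [V.IsElliptic] {α β : AddMonoid.End V.Point}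
    {n m k l : ℕ} (hα : HasDegree α n) (hβ : HasDegree β m) (hk : HasDegree (α + β) k)
    (hl : HasDegree (α - β) l) : k + l = 2 * (n + m) := by
  obtain ⟨v, hv, hvx⟩ := hα
  obtain ⟨w, hw, hwx⟩ := hβ
  obtain ⟨s, hs, hsx⟩ := hk
  obtain ⟨d, hd, hdx⟩ := hl
  rw [two_mul]
  have : Infinite K := IsAlgClosed.instInfinite
  refine (hs.symPair hd).degree_unique ((hv.symPair hw).kummer V) fun i j ↦
    eq_of_eventually_eval_eq ?_
  filter_upwards [hsx, hdx, eventually_eval_kummer hvx hwx] with x h₁ h₂ h₃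
  obtain ⟨y, hy⟩ := exists_nonsingular (V := V) x
  obtain ⟨κ₁, -, h₁⟩ := h₁ y hy
  obtain ⟨κ₂, -, h₂⟩ := h₂ y hy
  obtain ⟨κ₃, -, h₃⟩ := h₃ y hy
  have h₄ (i) : (symPair s d i).eval x = κ₁ * κ₂ *
      ((α + β) (Point.some x y hy)).sym2x ((α - β) (Point.some x y hy)) i := by
    simp only [eval_symPair, h₁, h₂, Point.sym2x]
    fin_cases i <;> simp <;> ring
  rw [eval_mul, eval_mul, h₃, h₃, h₄, h₄]
  ring

lemma HasDegree.unique [IsAlgClosed K] [V.IsElliptic] {α : AddMonoid.End V.Point} {n m : ℕ}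
    (hn : HasDegree α n) (hm : HasDegree α m) : n = m := by
  have := hm.parallelogram hasDegree_zero (k := n) (l := m) (by simpa) (by simpa)
  lia

/-- If `α`, `β` and `α - β` induce maps on `x`-coordinates, then so does `α + β`, because the
Kummer map determines the unordered pair of the `x`-coordinates of `α + β` and `α - β`. -/
lemma exists_hasDegree_add [IsAlgClosed K] [V.IsElliptic] {α β : AddMonoid.End V.Point}
    {n m l : ℕ} (hα : HasDegree α n) (hβ : HasDegree β m) (hl : HasDegree (α - β) l) :
    ∃ k, HasDegree (α + β) k := by
  obtain ⟨v, hv, hvx⟩ := hα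
  obtain ⟨w, hw, hwx⟩ := hβ
  obtain ⟨d, hd, hdx⟩ := hl
  set e := kummer V (symPair v w)
  -- `d 1 = 0` means that `α = β` up to finitely many points
  by_cases hd1 : d 1 = 0
  · refine exists_hasDegree_of_pair ![e 0, e 1] ?_
    filter_upwards [hdx, eventually_eval_kummer hvx hwx] with x h₂ h₃ y hy
    obtain ⟨κ₂, hκ₂, h₂⟩ := h₂ y hy
    obtain ⟨κ₃, hκ₃, h₃⟩ := h₃ y hy
    have hne := ((α - β) (Point.some x y hy)).xRep_ne_zero
    have h21 : ((α - β) (Point.some x y hy)).xRep 1 = 0 := by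
      simpa [hd1, hκ₂] using (h₂ 1).symm
    have h20 : ((α - β) (Point.some x y hy)).xRep 0 ≠ 0 := by
      intro h0
      apply hne
      funext i
      fin_cases i
      exacts [h0, h21]
    refine ⟨κ₃ * ((α - β) (Point.some x y hy)).xRep 0, mul_ne_zero hκ₃ h20, fun i ↦ ?_⟩
    fin_cases i
    · simp [e, h₃, Point.sym2x]; ring
    · simp [e, h₃, Point.sym2x, h21]; ring
  · refine exists_hasDegree_of_pair ![e 1 * d 1 - e 2 * d 0, e 2 * d 1] ?_
    filter_upwards [hdx, eventually_eval_kummer hvx hwx, eventually_eval_ne_zero hd1]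
      with x h₂ h₃ h₄ y hy
    obtain ⟨κ₂, hκ₂, h₂⟩ := h₂ y hy
    obtain ⟨κ₃, hκ₃, h₃⟩ := h₃ y hy
    have h21 : ((α - β) (Point.some x y hy)).xRep 1 ≠ 0 := by
      intro h0
      exact h₄ (by rw [h₂, h0, mul_zero])
    refine ⟨κ₃ * κ₂ * ((α - β) (Point.some x y hy)).xRep 1 ^ 2,
      mul_ne_zero (mul_ne_zero hκ₃ hκ₂) (pow_ne_zero 2 h21), fun i ↦ ?_⟩
    fin_cases i
    · simp [e, h₃, h₂, Point.sym2x]; ring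
    · simp [e, h₃, h₂, Point.sym2x]; ring

end

/-! ### Frobenius endomorphisms and kernels -/

section

open Polynomial Filter WeierstrassCurve.Affine

variable {K : Type*} [Field K] {V : WeierstrassCurve.Affine K}

/-- `F` raises the coordinates of affine points to the power `q`. -/
def IsPowerMap [DecidableEq K] (F : AddMonoid.End V.Point) (q : ℕ) : Prop :=
  ∀ (P : V.Point) (x y : K), HasCoords P x y → HasCoords (F P) (x ^ q) (y ^ q)

lemma IsPowerMap.mul [DecidableEq K] {F G : AddMonoid.End V.Point} {q r : ℕ} (hF : IsPowerMap F q)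
    (hG : IsPowerMap G r) : IsPowerMap (F * G) (r * q) := fun P x y h ↦ by
  rw [pow_mul, pow_mul]
  exact hF _ _ _ (hG P x y h)

lemma IsPowerMap.apply_some [DecidableEq K] {F : AddMonoid.End V.Point} {q : ℕ}
    (hF : IsPowerMap F q) {x y : K} (h : V.Nonsingular x y) :
    ∃ h', F (Point.some x y h) = Point.some (x ^ q) (y ^ q) h' :=
  hF _ _ _ ⟨h, rfl⟩

lemma tendsto_pow_cofinite {q : ℕ} (hq : q ≠ 0) :
    Tendsto (fun x : K ↦ x ^ q) cofinite cofinite := by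
  refine Tendsto.cofinite_of_finite_preimage_singleton fun c ↦ ?_
  refine ((X ^ q - C c).finite_setOfPred_isRoot (X_pow_sub_C_ne_zero hq.bot_lt c)).subset ?_
  intro x hx
  simpa [sub_eq_zero] using! hx

lemma HasDegree.mul_powerMap [DecidableEq K] {α F : AddMonoid.End V.Point} {n q : ℕ}
    (hα : HasDegree α n) (hF : IsPowerMap F q) (hq : q ≠ 0) : HasDegree (α * F) (n * q) := by
  obtain ⟨v, hv, hx⟩ := hα
  refine ⟨fun i ↦ expand K q (v i), ⟨fun i ↦ ?_, ?_, fun x ↦ ?_⟩, ?_⟩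
  · rw [natDegree_expand]
    exact Nat.mul_le_mul_right q (hv.natDegree_le i)
  · obtain ⟨i, hi⟩ := hv.exists_coeff_ne_zero
    exact ⟨i, by rwa [coeff_expand_mul hq.bot_lt]⟩
  · obtain ⟨i, hi⟩ := hv.exists_eval_ne_zero (x ^ q)
    exact ⟨i, by rwa [expand_eval]⟩
  · filter_upwards [(tendsto_pow_cofinite hq).eventually hx] with x hx y h
    obtain ⟨h', hF'⟩ := hF.apply_some h
    obtain ⟨κ, hκ, hi⟩ := hx _ h'
    refine ⟨κ, hκ, fun i ↦ ?_⟩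
    rw [expand_eval, hi, end_mul_apply, hF']

lemma IsPowerMap.hasDegree [DecidableEq K] {F : AddMonoid.End V.Point} {q : ℕ}
    (hF : IsPowerMap F q) (hq : q ≠ 0) : HasDegree F q := by
  simpa using hasDegree_one.mul_powerMap hF hq

/-- Modulo the equation of the curve, a power of `y` is linear in `y`. -/
lemma exists_pow_eq_add_mul (V : WeierstrassCurve.Affine K) (q : ℕ) :
    ∃ g h : K[X], ∀ x y, V.Equation x y → y ^ q = g.eval x + h.eval x * y := by
  induction q with
  | zero => exact ⟨1, 0, by simp⟩
  | succ q ih =>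
    obtain ⟨g, h, hgh⟩ := ih
    refine ⟨h * (X ^ 3 + C V.a₂ * X ^ 2 + C V.a₄ * X + C V.a₆),
      g - h * (C V.a₁ * X + C V.a₃), fun x y hxy ↦ ?_⟩
    have := (V.equation_iff x y).1 hxy
    rw [pow_succ, hgh x y hxy]
    simp
    linear_combination h.eval x * this

/-- The `x`-coordinate of `P - F P` is an even rational function on the curve, hence a rational
function of the `x`-coordinate of `P`. -/
lemma IsPowerMap.exists_hasDegree_one_sub [DecidableEq K] [IsAlgClosed K] [V.IsElliptic]
    {F : AddMonoid.End V.Point} {q : ℕ} (hF : IsPowerMap F q) (hq : 1 < q) :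
    ∃ n, HasDegree (1 - F) n := by
  have : Infinite K := IsAlgClosed.instInfinite
  obtain ⟨g, h, hgh⟩ := exists_pow_eq_add_mul V q
  -- the slope of the line through `P` and `-F P` is `(G + H y) / w`
  set G : K[X] := g + C V.a₁ * X ^ q + C V.a₃ with hG
  set H : K[X] := h + 1 with hH
  set w : K[X] := X - X ^ q with hw
  set A : K[X] := G ^ 2 + H ^ 2 * (X ^ 3 + C V.a₂ * X ^ 2 + C V.a₄ * X + C V.a₆) +
    C V.a₁ * w * G - (C V.a₂ + X + X ^ q) * w ^ 2 with hA
  set B : K[X] := 2 * G * H - H ^ 2 * (C V.a₁ * X + C V.a₃) + C V.a₁ * w * H with hB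
  have hw0 : w ≠ 0 := by
    intro h0
    have : w.coeff q = -1 := by simp [hw, coeff_X, hq.ne]
    rw [h0, coeff_zero] at this
    simp at this
  have key (x y : K) (hxy : V.Nonsingular x y) (hwx : w.eval x ≠ 0) :
      ∀ i, ![A.eval x + B.eval x * y, w.eval x ^ 2] i =
        w.eval x ^ 2 * ((1 - F) (Point.some x y hxy)).xRep i := by
    obtain ⟨h', hF'⟩ := hF.apply_some hxy
    have hx : x - x ^ q ≠ 0 := by simpa [hw] using hwx
    have hyq := hgh x y hxy.1
    have heq := (V.equation_iff x y).1 hxy.1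
    rw [end_sub_apply, AddMonoid.End.one_apply, hF', sub_eq_add_neg, Point.neg_some,
      Point.add_of_X_ne (sub_ne_zero.1 hx)]
    intro i
    fin_cases i
    · simp only [Point.xRep_some, addX, slope_of_X_ne (sub_ne_zero.1 hx), negY, hyq]
      simp [hA, hB, hG, hH, hw]
      field_simp
      linear_combination (-(h.eval x + 1) ^ 2) * heq
    · simp
  -- as `P` and `-P` give the same value, the part that is linear in `y` vanishes
  have hB0 : B = 0 := by
    refine eq_of_eventually_eval_eq ?_
    filter_upwards [eventually_eval_ne_zero hw0, eventually_two_mul_add_ne_zero (V := V)]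
      with x hwx h2
    obtain ⟨y, hy⟩ := exists_nonsingular (V := V) x
    have h1 := key x y hy hwx 0
    have h2' := key x _ ((V.nonsingular_neg x y).2 hy) hwx 0
    rw [← Point.neg_some hy, map_neg, Point.xRep_neg, ← h1] at h2'
    simp only [Matrix.cons_val_zero, negY] at h2'
    have : B.eval x * (2 * y + V.a₁ * x + V.a₃) = 0 := by linear_combination -h2'
    simpa [h2 y hy] using this
  refine exists_hasDegree_of_pair ![A, w ^ 2] ?_
  filter_upwards [eventually_eval_ne_zero hw0] with x hwx y hy
  refine ⟨w.eval x ^ 2, pow_ne_zero 2 hwx, fun i ↦ ?_⟩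
  rw [← key x y hy hwx i]
  fin_cases i <;> simp [hB0]

section Kernel

lemma finite_preimage_xRep {s : Set (Fin 2 → K)} (hs : s.Finite) :
    (Point.xRep (W' := V) ⁻¹' s).Finite := by
  refine hs.preimage' fun z _ ↦ ?_
  rcases (Point.xRep (W' := V) ⁻¹' {z}).eq_empty_or_nonempty with h | ⟨P, hP⟩
  · simp [h]
  · refine (Set.toFinite {P, -P}).subset fun Q hQ ↦ ?_
    exact Point.eq_or_eq_neg_of_xRep_eq_xRep (hQ.trans hP.symm)

lemma infinite_point [IsAlgClosed K] [V.IsElliptic] : Infinite V.Point := by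
  have : Infinite K := IsAlgClosed.instInfinite
  choose y hy using exists_nonsingular (V := V)
  refine Infinite.of_injective (fun x ↦ Point.some x (y x) (hy x)) fun x x' h ↦ ?_
  simpa using (Point.some.inj h).1

/-- An endomorphism of degree `n` has at most `n` elements in its kernel: the `x`-coordinates of
the points over a general point `Q` are distinct zeros of a polynomial of degree at most `n`. -/
lemma HasDegree.card_ker_le [DecidableEq K] [IsAlgClosed K] [V.IsElliptic]
    {α : AddMonoid.End V.Point} {n : ℕ} (hα : HasDegree α n)
    (hfin : {T | α T = 0}.Finite) : Nat.card {T // α T = 0} ≤ n := by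
  have hinf : Infinite V.Point := infinite_point
  obtain ⟨v, hv, hx⟩ := hα
  -- the points over which the description of `α` may fail, and those fixed by negation
  set bad : Set V.Point := Point.xRep ⁻¹' (insert ![1, 0] ((fun x ↦ ![x, 1]) ''
    {x | ¬ ((∀ y (h : V.Nonsingular x y), ∃ κ : K, κ ≠ 0 ∧
      ∀ i, (v i).eval x = κ * (α (Point.some x y h)).xRep i) ∧
      ∀ y, V.Nonsingular x y → 2 * y + V.a₁ * x + V.a₃ ≠ 0)})) with hbad
  have hbadfin : bad.Finite := finite_preimage_xRep
    (((hx.and eventually_two_mul_add_ne_zero).image _).insert _)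
  have hzero : (0 : V.Point) ∈ bad := by simp [hbad]
  have hgood {x y : K} {h : V.Nonsingular x y} (hP : Point.some x y h ∉ bad) :
      (∃ κ : K, κ ≠ 0 ∧ ∀ i, (v i).eval x = κ * (α (Point.some x y h)).xRep i) ∧
        2 * y + V.a₁ * x + V.a₃ ≠ 0 := by
    simp only [hbad, Set.mem_preimage, Point.xRep_some, Set.mem_insert_iff, Set.mem_image,
      not_or, not_exists, not_and] at hP
    by_contra hc
    exact hP.2 x (fun hh hh' ↦ hc ⟨hh y h, hh' y h⟩) rfl
  have hneg {P : V.Point} (hP : P ∉ bad) : P ≠ -P := by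
    match P with
    | 0 => exact absurd hzero hP
    | Point.some x y h =>
      intro h0
      rw [Point.neg_some] at h0
      apply (hgood hP).2
      have := (Point.some.inj h0).2
      rw [negY] at this
      linear_combination this
  have hfiber (s : Set V.Point) (hs : s.Finite) : (α ⁻¹' s).Finite := by
    refine hs.preimage' fun Q _ ↦ ?_
    rcases (α ⁻¹' {Q}).eq_empty_or_nonempty with h | ⟨P, hP⟩
    · simp [h]
    · refine (hfin.image (P + ·)).subset
        fun R hR ↦ ⟨R - P, ?_, by simp⟩
      exact (map_sub α R P).trans (sub_eq_zero.2 (hR.trans hP.symm))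
  -- a point `P` with image outside the bad points and outside their images
  obtain ⟨P, hP⟩ := (hfiber _ (hbadfin.union (hbadfin.image α))).exists_notMem
  obtain ⟨hPQ, hPα⟩ := not_or.1 hP
  have hQ := hneg hPQ
  obtain ⟨X₀, Y₀, hXY, hPXY⟩ : ∃ x y h, α P = Point.some x y h := by
    match hc : α P with
    | 0 => exact absurd (hc ▸ hzero) hPQ
    | Point.some x y h => exact ⟨x, y, h, rfl⟩
  have hgood' (R : V.Point) (hR : α R = α P) :
      ∃ x y h, R = Point.some x y h ∧ (v 0 - C X₀ * v 1).eval x = 0 := by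
    have hRb : R ∉ bad := fun hb ↦ hPα ⟨R, hb, hR⟩
    match R with
    | 0 => exact absurd hzero hRb
    | Point.some x y h =>
      refine ⟨x, y, h, rfl, ?_⟩
      obtain ⟨κ, -, hi⟩ := (hgood hRb).1
      have h0 := hi 0
      have h1 := hi 1
      rw [hR, hPXY] at h0 h1
      simp at h0 h1
      simp [h0, h1]
      ring
  have hD : v 0 - C X₀ * v 1 ≠ 0 := by
    intro h0
    -- otherwise `α` would be constant up to sign
    have hfin'' : (bad ∪ α ⁻¹' {α P, -α P}).Finite := hbadfin.union (hfiber _ (Set.toFinite _))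
    obtain ⟨R, hR⟩ := hfin''.exists_notMem
    simp only [Set.mem_union, not_or] at hR
    match R with
    | 0 => exact hR.1 hzero
    | Point.some x y h =>
      obtain ⟨⟨κ, hκ, hi⟩, -⟩ := hgood hR.1
      have hv01 : (v 0).eval x = X₀ * (v 1).eval x := by
        have := congrArg (eval x) h0
        simpa [sub_eq_zero] using this
      apply hR.2
      apply Point.eq_or_eq_neg_of_xRep_eq_xRep
      rw [hPXY]
      rw [hi, hi] at hv01
      match hc : α (Point.some x y h) with
      | 0 => simp [hc, hκ, ← Point.zero_def] at hv01
      | Point.some x' y' h'' =>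
        simp [hc] at hv01
        have : x' = X₀ := mul_left_cancel₀ hκ (by linear_combination hv01)
        simp [this]
  choose! x y h hR hroot using hgood'
  have hroot' (T : {T // α T = 0}) : α (P + T) = α P := by
    rw [map_add, T.2, add_zero]
  have hinj : Function.Injective
      (fun T : {T // α T = 0} ↦ (⟨x (P + T), by
        simpa [hD] using hroot _ (hroot' T)⟩ : (v 0 - C X₀ * v 1).roots.toFinset)) := by
    intro T T' hTT
    have hxx : x (P + T) = x (P + T') := congrArg Subtype.val hTT
    have hc : P + T = P + T' ∨ P + T = -(P + T') := by
      apply Point.eq_or_eq_neg_of_xRep_eq_xRep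
      rw [hR _ (hroot' T), hR _ (hroot' T')]
      simp [hxx]
    rcases hc with hc | hc
    · exact Subtype.ext (add_left_cancel hc)
    · refine absurd ?_ hQ
      nth_rw 1 [← hroot' T, hc, map_neg, hroot' T']
  calc Nat.card {T // α T = 0} ≤ Nat.card (v 0 - C X₀ * v 1).roots.toFinset :=
        Nat.card_le_card_of_injective _ hinj
    _ ≤ (v 0 - C X₀ * v 1).natDegree := by
        rw [Nat.card_eq_fintype_card, Fintype.card_coe]
        exact (Multiset.toFinset_card_le _).trans (card_roots' _)
    _ ≤ n := (natDegree_sub_le_of_le (hv.natDegree_le 0)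
        ((natDegree_C_mul_le _ _).trans (hv.natDegree_le 1))).trans (by simp)

end Kernel

end

/-! ### Counting the points fixed up to sign by Frobenius -/

section

open Polynomial Filter WeierstrassCurve.Affine

variable {K : Type*} [Field K] {V : WeierstrassCurve.Affine K}

/-- If `F P = ± P`, then the pair `{P, -P}`, counted twice when `P = -P`, is distributed over the
fixed points of `F` and those of `-F`. -/
lemma exists_injective_fixed_sum {A : Type*} [AddCommGroup A] (F : AddMonoid.End A) {P : A}
    (h : F P = P ∨ F P = -P) :
    ∃ f : Bool → {Q // (F - 1) Q = 0} ⊕ {Q // (F + 1) Q = 0}, Function.Injective f ∧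
      ∀ b, Sum.elim Subtype.val Subtype.val (f b) = P ∨
        Sum.elim Subtype.val Subtype.val (f b) = -P := by
  have h₁ (Q : A) : (F - 1) Q = 0 ↔ F Q = Q := by
    rw [end_sub_apply, AddMonoid.End.one_apply, sub_eq_zero]
  have h₂ (Q : A) : (F + 1) Q = 0 ↔ F Q = -Q := by
    rw [end_add_apply, AddMonoid.End.one_apply, add_eq_zero_iff_eq_neg]
  by_cases hP : P = -P
  · have hF : F P = P := by
      rcases h with h | h
      · exact h
      · exact h.trans hP.symm
    refine ⟨fun b ↦ if b then .inl ⟨P, (h₁ P).2 hF⟩ else .inr ⟨P, (h₂ P).2 (hF.trans hP)⟩,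
      fun b b' ↦ by cases b <;> cases b' <;> simp, fun b ↦ by cases b <;> simp⟩
  · rcases h with h | h
    · refine ⟨fun b ↦ if b then .inl ⟨P, (h₁ P).2 h⟩ else
        .inl ⟨-P, (h₁ _).2 (by rw [map_neg, h])⟩, fun b b' ↦ ?_, fun b ↦ by cases b <;> simp⟩
      cases b <;> cases b' <;> simp [hP, Ne.symm hP]
    · refine ⟨fun b ↦ if b then .inr ⟨P, (h₂ P).2 h⟩ else
        .inr ⟨-P, (h₂ _).2 (by rw [map_neg, h])⟩, fun b b' ↦ ?_, fun b ↦ by cases b <;> simp⟩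
      cases b <;> cases b' <;> simp [hP, Ne.symm hP]

variable [DecidableEq K]

lemma IsPowerMap.apply_eq_or_eq_neg {F : AddMonoid.End V.Point} {q : ℕ} (hF : IsPowerMap F q)
    {x y : K} (h : V.Nonsingular x y) (hx : x ^ q = x) :
    F (Point.some x y h) = Point.some x y h ∨ F (Point.some x y h) = -Point.some x y h := by
  obtain ⟨h', hF'⟩ := hF.apply_some h
  rw [hF']
  exact Point.X_eq_iff.1 hx

lemma IsPowerMap.finite_fixed {F : AddMonoid.End V.Point} {q : ℕ} (hF : IsPowerMap F q)
    (hq : 1 < q) : {P | F P = P ∨ F P = -P}.Finite := by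
  have hfin : {x : K | x ^ q = x}.Finite := by
    have h0 : (X ^ q - X : K[X]) ≠ 0 := by
      intro h0
      have : (X ^ q - X : K[X]).coeff q = 1 := by simp [coeff_X, hq.ne]
      rw [h0, coeff_zero] at this
      simp at this
    refine ((X ^ q - X : K[X]).finite_setOfPred_isRoot h0).subset fun x hx ↦ ?_
    simpa [sub_eq_zero] using! hx
  refine (finite_preimage_xRep ((hfin.image fun x ↦ ![x, 1]).insert ![1, 0])).subset ?_
  intro P hP
  match P with
  | 0 => simp
  | Point.some x y h =>
    refine Or.inr ⟨x, ?_, by simp⟩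
    obtain ⟨h', hF'⟩ := hF.apply_some h
    change F _ = _ ∨ F _ = _ at hP
    rw [hF'] at hP
    exact Point.X_eq_iff.2 hP

/-- Each of the `q` elements of the field with `q` elements, and the point at infinity, is the
`x`-coordinate of two points, counted with multiplicity, that `F` fixes up to sign. -/
lemma IsPowerMap.le_card_fixed_add [IsAlgClosed K] [V.IsElliptic] (p : ℕ) [CharP K p]
    {F : AddMonoid.End V.Point} {q : ℕ} (hF : IsPowerMap F q) (hq : 1 < q) (hpq : p ∣ q) :
    2 * (q + 1) ≤ Nat.card {P // (F - 1) P = 0} + Nat.card {P // (F + 1) P = 0} := by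
  have hs : (X ^ q - X : K[X]).Separable := galois_poly_separable p q hpq
  have hcard : Fintype.card ((X ^ q - X : K[X]).rootSet K) = q := by
    rw [card_rootSet_eq_natDegree hs (IsAlgClosed.splits _),
      FiniteField.X_pow_card_sub_X_natDegree_eq _ hq]
  have hx (x : (X ^ q - X : K[X]).rootSet K) : (x : K) ^ q = x := by
    have := (mem_rootSet.1 x.2).2
    simpa [sub_eq_zero] using this
  choose y hy using exists_nonsingular (V := V)
  let P : Option ((X ^ q - X : K[X]).rootSet K) → V.Point
    | none => 0
    | some x => Point.some x (y x) (hy x)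
  have hP (z) : F (P z) = P z ∨ F (P z) = -P z := by
    match z with
    | none => simp [P]
    | some x => exact hF.apply_eq_or_eq_neg _ (hx x)
  have hPinj {z z'} (h : (P z).xRep = (P z').xRep) : z = z' := by
    match z, z' with
    | none, none => rfl
    | none, some x => simp [P] at h
    | some x, none => simp [P] at h
    | some x, some x' =>
      simp [P] at h
      exact congrArg some (Subtype.ext h)
  choose f hf hfP using fun z ↦ exists_injective_fixed_sum F (hP z)
  have hfx (z b) : (Sum.elim Subtype.val Subtype.val (f z b) : V.Point).xRep = (P z).xRep := by
    rcases hfP z b with h | h <;> simp [h]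
  have hfin := hF.finite_fixed hq
  have : Finite {P // (F - 1) P = 0} := hfin.subset fun P h ↦ .inl (sub_eq_zero.1 h)
  have : Finite {P // (F + 1) P = 0} := hfin.subset fun P h ↦ .inr (eq_neg_of_add_eq_zero_left h)
  have hinj : Function.Injective (fun z : Option ((X ^ q - X : K[X]).rootSet K) × Bool ↦
      f z.1 z.2) := by
    rintro ⟨z, b⟩ ⟨z', b'⟩ h
    have hz : z = z' := hPinj (by rw [← hfx z b, ← hfx z' b']; exact congrArg _ (congrArg _ h))
    subst hz
    exact congrArg _ (hf z h)
  have := Nat.card_le_card_of_injective _ hinj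
  rw [Nat.card_sum, Nat.card_prod, Nat.card_eq_fintype_card, Nat.card_eq_fintype_card,
    Fintype.card_option, hcard, Fintype.card_bool] at this
  lia

/-- The fixed points of `-F` are as many as the degree of `F + 1`: the bounds for the kernels of
`F - 1` and of `F + 1` by the degrees are sharp, as the sums of both sides agree. -/
lemma IsPowerMap.card_ker_add_one [IsAlgClosed K] [V.IsElliptic] (p : ℕ) [CharP K p]
    {F : AddMonoid.End V.Point} {q : ℕ} (hF : IsPowerMap F q) (hq : 1 < q) (hpq : p ∣ q) {n : ℕ}
    (hn : HasDegree (F + 1) n) : Nat.card {P // (F + 1) P = 0} = n := by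
  have hfin := hF.finite_fixed hq
  obtain ⟨m, hm⟩ := hF.exists_hasDegree_one_sub hq
  replace hm : HasDegree (F - 1) m := by simpa using hm.neg
  have h₁ := hm.card_ker_le (hfin.subset fun P h ↦ .inl (sub_eq_zero.1 h))
  have h₂ := hn.card_ker_le (hfin.subset fun P h ↦ .inr (eq_neg_of_add_eq_zero_left h))
  have h₃ := hF.le_card_fixed_add p hq hpq
  have h₄ := (hF.hasDegree (by lia)).parallelogram hasDegree_one hn hm
  lia

end

/-! ### The degree form on the ring generated by Frobenius -/

section

open Polynomial Filter WeierstrassCurve.Affine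

lemma int_induction_two_step {P : ℤ → Prop} (h0 : P 0) (h1 : P 1)
    (hup : ∀ n, P n → P (n + 1) → P (n + 2)) (hdown : ∀ n, P (n + 2) → P (n + 1) → P n) (n : ℤ) :
    P n := by
  suffices P n ∧ P (n + 1) from this.1
  induction n with
  | zero => exact ⟨h0, by simpa using h1⟩
  | succ n ih =>
    refine ⟨ih.2, ?_⟩
    rw [add_assoc, one_add_one_eq_two]
    exact hup _ ih.1 ih.2
  | pred n ih =>
    refine ⟨hdown _ ?_ ?_, by simpa using ih.1⟩
    · convert ih.2 using 1
      ring
    · convert ih.1 using 1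
      ring

variable {K : Type*} [Field K] [DecidableEq K] [IsAlgClosed K] {V : WeierstrassCurve.Affine K}
  [V.IsElliptic]

/-- By the parallelogram law, the degree is a quadratic form on `ℤ + ℤ F`; its value at `1 - F`,
written as `q + 1 - t`, determines it. -/
lemma IsPowerMap.hasDegree_add {F : AddMonoid.End V.Point} {q : ℕ} (hF : IsPowerMap F q)
    (hq : 1 < q) {m : ℕ} (hm : HasDegree (1 - F) m) {t : ℤ} (ht : (m : ℤ) = q + 1 - t) (i j : ℤ) :
    ∃ n, HasDegree (i • (1 : AddMonoid.End V.Point) + j • F) n ∧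
      (n : ℤ) = i ^ 2 + t * i * j + q * j ^ 2 := by
  set good : ℤ → ℤ → Prop := fun i j ↦ ∃ n,
    HasDegree (i • (1 : AddMonoid.End V.Point) + j • F) n ∧
      (n : ℤ) = i ^ 2 + t * i * j + q * j ^ 2
  have hadd {i j i' j' : ℤ} (h : good i j) (h' : good i' j') (hd : good (i - i') (j - j')) :
      good (i + i') (j + j') := by
    obtain ⟨n, hn, hn'⟩ := h
    obtain ⟨k, hk, hk'⟩ := h'
    obtain ⟨l, hl, hl'⟩ := hd
    have e₁ : (i - i') • (1 : AddMonoid.End V.Point) + (j - j') • F =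
        (i • 1 + j • F) - (i' • 1 + j' • F) := by
      simp only [sub_zsmul]; abel
    have e₂ : (i + i') • (1 : AddMonoid.End V.Point) + (j + j') • F =
        (i • 1 + j • F) + (i' • 1 + j' • F) := by
      simp only [add_zsmul]; abel
    rw [e₁] at hl
    obtain ⟨r, hr⟩ := exists_hasDegree_add hn hk hl
    refine ⟨r, e₂ ▸ hr, ?_⟩
    have := hn.parallelogram hk hr hl
    zify at this
    rw [hn', hk', hl'] at this
    linear_combination this
  have hneg {i j : ℤ} (h : good i j) : good (-i) (-j) := by
    obtain ⟨n, hn, hn'⟩ := h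
    refine ⟨n, ?_, by rw [hn']; ring⟩
    convert hn.neg using 1
    simp only [neg_zsmul]; abel
  have hline {a b i j : ℤ} (hab : good a b) (h0 : good i j) (h1 : good (i + a) (j + b)) (n : ℤ) :
      good (i + n * a) (j + n * b) := by
    refine int_induction_two_step (P := fun n ↦ good (i + n * a) (j + n * b)) (by simpa)
      (by simpa) (fun n h h' ↦ ?_) (fun n h h' ↦ ?_) n
    · convert hadd h' hab (by convert h using 1 <;> ring) using 1 <;> ring
    · convert hadd h' (hneg hab) (by convert h using 1 <;> ring) using 1 <;> ring
  have h00 : good 0 0 := ⟨0, by simpa using hasDegree_zero, by simp⟩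
  have h10 : good 1 0 := ⟨1, by simpa using hasDegree_one, by simp⟩
  have h01 : good 0 1 := ⟨q, by simpa using hF.hasDegree (by lia), by simp⟩
  have h11 : good 1 (-1) := ⟨m, by simpa [sub_eq_add_neg] using hm, by rw [ht]; ring⟩
  -- by steps of `F` from `0` and from `1`, then by steps of `1`
  have h0j (j : ℤ) : good 0 j := by simpa using hline h01 h00 (by simpa) j
  have h1j (j : ℤ) : good 1 j := by
    have := hline h01 h11 (by simpa) (j + 1)
    simpa using this
  have := hline h10 (h0j j) (by simpa using h1j j) i
  rwa [zero_add, mul_one, mul_zero, add_zero] at this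

/-- Over a field of characteristic `p`, let `F` be the `p`-power Frobenius endomorphism of an
ordinary curve. Any monic integral quadratic equation of `F` has constant term `p`, and then its
linear coefficient gives the number of fixed points of `-F ^ 2`. -/
lemma IsPowerMap.card_ker_mul_self_add_one {p : ℕ} [Fact p.Prime] [CharP K p]
    {F : AddMonoid.End V.Point} (hF : IsPowerMap F p)
    (hord : ∃ P : V.Point, P ≠ 0 ∧ p • P = 0) {T M : ℤ}
    (hTM : F * F = T • F - M • (1 : AddMonoid.End V.Point)) :
    M = p ∧ (Nat.card {P // (F * F + 1) P = 0} : ℤ) = (1 - M) ^ 2 + T ^ 2 := by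
  have hp : p.Prime := Fact.out
  obtain ⟨m, hm⟩ := hF.exists_hasDegree_one_sub hp.one_lt
  obtain ⟨t, ht⟩ : ∃ t : ℤ, (m : ℤ) = p + 1 - t := ⟨p + 1 - m, by ring⟩
  have hform := hF.hasDegree_add hp.one_lt hm ht
  have hp0 : (p : ℤ) ≠ 0 := by exact_mod_cast hp.ne_zero
  -- the degrees of `F ^ 2` and of `(F - 1) F`, computed in two ways
  have h₁ : (p : ℤ) * p = M ^ 2 - t * M * T + p * T ^ 2 := by
    obtain ⟨n, hn, hn'⟩ := hform (-M) T
    have e : (-M) • (1 : AddMonoid.End V.Point) + T • F = F * F := by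
      rw [hTM]; simp only [neg_zsmul]; abel
    rw [e] at hn
    have := hn.unique ((hF.hasDegree hp.ne_zero).mul_powerMap hF hp.ne_zero)
    rw [this] at hn'
    push_cast at hn'
    linear_combination hn'
  have h₂ : (p + 1 - t) * p = M ^ 2 - t * M * (T - 1) + p * (T - 1) ^ 2 := by
    obtain ⟨n, hn, hn'⟩ := hform (-M) (T - 1)
    have e : (-M) • (1 : AddMonoid.End V.Point) + (T - 1) • F = -((1 - F) * F) := by
      rw [sub_mul, one_mul, hTM]; simp only [sub_zsmul, neg_zsmul, one_zsmul]; abel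
    rw [e] at hn
    have := hn.unique (hm.mul_powerMap hF hp.ne_zero).neg
    rw [this] at hn'
    push_cast at hn'
    rw [← ht]
    linear_combination hn'
  have h₃ : t * (M + p) = 2 * p * T := by linear_combination h₁ - h₂
  have h₄ : (M + p) * ((M - p) * (4 * p - t ^ 2)) = 0 := by
    linear_combination (-4 * p) * h₁ + (2 * p * T + t * (M + p) - 2 * t * M) * h₃
  -- a prime is not a square
  have hpt : 4 * (p : ℤ) - t ^ 2 ≠ 0 := by
    intro h0
    have hpp : Prime (p : ℤ) := Nat.prime_iff_prime_int.1 hp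
    obtain ⟨s, rfl⟩ : (2 : ℤ) ∣ t :=
      Int.prime_two.dvd_of_dvd_pow (n := 2) ⟨2 * p, by linear_combination -h0⟩
    have hs : (p : ℤ) = s * s :=
      mul_left_cancel₀ (four_ne_zero (α := ℤ)) (by linear_combination h0)
    obtain ⟨r, rfl⟩ : (p : ℤ) ∣ s := hpp.dvd_of_dvd_pow (n := 2) ⟨1, by linear_combination -hs⟩
    have : (p : ℤ) * r ^ 2 = 1 := mul_left_cancel₀ hp0 (by linear_combination -hs)
    exact hpp.not_isUnit (IsUnit.of_mul_eq_one _ this)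
  have hMp : M = p := by
    rcases mul_eq_zero.1 h₄ with h | h
    · -- here `F ^ 2 = p`, while `F` is injective and `p` is not
      exfalso
      have hT : T = 0 := by
        rw [h, mul_zero] at h₃
        simpa [hp.ne_zero] using h₃.symm
      obtain ⟨P, hP0, hP⟩ := hord
      have hinj (Q : V.Point) (hQ : F Q = 0) : Q = 0 := by
        match Q with
        | 0 => rfl
        | Point.some x y h =>
          obtain ⟨h', hF'⟩ := hF.apply_some h
          rw [hF'] at hQ
          exact absurd hQ (Point.some_ne_zero h')
      refine hP0 (hinj _ (hinj _ ?_))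
      have := congrArg (fun α : AddMonoid.End V.Point ↦ α P) hTM
      have hM : M = -p := by linear_combination h
      simpa [hT, hM, end_mul_apply, end_neg_apply, hP] using this
    · rcases mul_eq_zero.1 h with h | h
      · exact sub_eq_zero.1 h
      · exact absurd h hpt
  refine ⟨hMp, ?_⟩
  have hTt : T = t := by
    rw [hMp] at h₃
    exact mul_left_cancel₀ (mul_ne_zero two_ne_zero hp0) (by linear_combination -h₃)
  obtain ⟨n, hn, hn'⟩ := hform (1 - M) T
  have e : (1 - M) • (1 : AddMonoid.End V.Point) + T • F = F * F + 1 := by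
    rw [hTM]; simp only [sub_zsmul, one_zsmul]; abel
  rw [e] at hn
  rw [(hF.mul hF).card_ker_add_one p (by nlinarith [hp.one_lt]) (dvd_mul_right p p) hn, hn', ← hTt,
    hMp]
  ring

end

/-! ### Conjugation, twists and lattices -/

section

open Polynomial WeierstrassCurve.Affine

section Conj

variable {A B : Type*} [AddCommGroup A] [AddCommGroup B]

lemma conj_apply (τ : A ≃+ B) (α : AddMonoid.End A) (P : B) : conj τ α P = τ (α (τ.symm P)) := rfl

/-- Conjugation by an isomorphism, as a homomorphism of endomorphism rings. -/
def conjHom (τ : A ≃+ B) : AddMonoid.End A →+* AddMonoid.End B where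
  toFun := conj τ
  map_one' := by ext P; simp [conj_apply]
  map_mul' α β := by ext P; simp [conj_apply, end_mul_apply]
  map_zero' := by ext P; simp [conj_apply]
  map_add' α β := by ext P; simp [conj_apply, end_add_apply]

lemma conjHom_injective (τ : A ≃+ B) : Function.Injective (conjHom τ) := by
  intro α β h
  ext P
  simpa [conjHom, conj_apply] using congrArg (fun γ : AddMonoid.End B ↦ γ (τ P)) h

lemma minpoly_conj (τ : A ≃+ B) (α : AddMonoid.End A) : minpoly ℤ (conj τ α) = minpoly ℤ α :=
  minpoly.algHom_eq (conjHom τ).toIntAlgHom (conjHom_injective τ) α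

lemma IsQuadratic.apply_apply {α : AddMonoid.End A} (h : IsQuadratic α) (P : A) :
    α (α P) = endTrace α • α P - endNorm α • P := by
  have hint : IsIntegral ℤ α := by
    by_contra hn
    rw [IsQuadratic, minpoly.eq_zero hn] at h
    simp at h
  have h2 : (minpoly ℤ α).coeff 2 = 1 := by
    have := minpoly.monic hint
    rwa [Polynomial.Monic, Polynomial.leadingCoeff, h] at this
  have h0 := minpoly.aeval ℤ α
  rw [Polynomial.aeval_eq_sum_range, h] at h0
  simp only [Finset.sum_range_succ, Finset.sum_range_zero, h2] at h0
  have := congrArg (fun γ : AddMonoid.End A ↦ γ P) h0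
  simp [end_add_apply, end_mul_apply, pow_two] at this
  rw [endTrace, endNorm, neg_smul]
  rw [← sub_eq_zero, ← this]
  abel

end Conj

lemma mem_range_algebraMap_of_pow_card_eq {k L : Type*} [Field k] [Fintype k] [Field L]
    [Algebra k L] {x : L} (h : x ^ Fintype.card k = x) : x ∈ (algebraMap k L).range := by
  have hs : (X ^ Fintype.card k - X : k[X]).Splits := by
    rw [splits_iff_card_roots, FiniteField.roots_X_pow_card_sub_X, ← Finset.card_def,
      Finset.card_univ, FiniteField.X_pow_card_sub_X_natDegree_eq _ Fintype.one_lt_card]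
  refine hs.mem_range_of_isRoot (FiniteField.X_pow_card_sub_X_ne_zero k Fintype.one_lt_card) ?_
  simp [h]

lemma mem_rationalPoints_iff {k L : Type*} [Field k] [Fintype k] [DecidableEq k] [Field L]
    [DecidableEq L] [Algebra k L] (E : WeierstrassCurve k) {x y : L}
    (h : (E.baseChange L).toAffine.Nonsingular x y) :
    Point.some x y h ∈ rationalPoints L E ↔ x ^ Fintype.card k = x ∧ y ^ Fintype.card k = y := by
  constructor
  · rintro ⟨P, hP⟩
    match P with
    | 0 => exact absurd hP.symm (Point.some_ne_zero h)
    | Point.some a b hab =>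
      obtain ⟨rfl, rfl⟩ := Point.some.inj hP
      simp [← map_pow, FiniteField.pow_card]
  · rintro ⟨hx, hy⟩
    obtain ⟨a, rfl⟩ := mem_range_algebraMap_of_pow_card_eq hx
    obtain ⟨b, rfl⟩ := mem_range_algebraMap_of_pow_card_eq hy
    have hab : (E.baseChange k).toAffine.Nonsingular a b :=
      (baseChange_nonsingular (W := E) (f := Algebra.ofId k L) (Algebra.ofId k L).injective a b).1 h
    exact ⟨Point.some a b hab, rfl⟩

lemma isPowerMap_frob {F L : Type*} [Field F] [Fintype F] [Field L] [DecidableEq L] [Algebra F L]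
    (E : WeierstrassCurve F) : IsPowerMap (frob L E) (Fintype.card F) := by
  rintro _ x y ⟨h, rfl⟩
  exact ⟨_, rfl⟩

/-- The `#k`-power Frobenius endomorphism of a quadratic twist `E'` is the negative of the
conjugate of that of `E₀`, so that `E'(k)` consists of the points that the latter maps to their
negatives. -/
lemma IsQuadraticTwist.mem_rationalPoints_iff {F k L : Type*} [Field F] [Field k] [Fintype k]
    [DecidableEq k] [Field L] [DecidableEq L] [Algebra F L] [Algebra k L]
    {E₀ : WeierstrassCurve F} {E' : WeierstrassCurve k} {τ : Pts E₀ L ≃+ Pts E' L}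
    (hτ : IsQuadraticTwist E₀ E' τ) {Φ : AddMonoid.End (Pts E₀ L)}
    (hΦ : IsPowerMap Φ (Fintype.card k)) (P : Pts E' L) :
    P ∈ rationalPoints L E' ↔ (Φ + 1) (τ.symm P) = 0 := by
  obtain ⟨u, r, s, t, hu, h₁, h₂⟩ := hτ
  obtain ⟨Q, rfl⟩ := τ.surjective P
  rw [τ.symm_apply_apply, end_add_apply, AddMonoid.End.one_apply]
  match Q with
  | 0 => exact iff_of_true (by simp) (by simp)
  | Point.some x y h =>
    obtain ⟨h', hτQ⟩ := h₁ _ x y ⟨h, rfl⟩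
    obtain ⟨h'', hΦτ⟩ := h₂ _ _ _ (hΦ _ x y ⟨h, rfl⟩)
    have hadd (a b : L) : (a + b) ^ Fintype.card k = a ^ Fintype.card k + b ^ Fintype.card k :=
      map_add (FiniteField.frobeniusAlgHom k L) a b
    rw [← τ.map_eq_zero_iff, map_add, add_eq_zero_iff_neg_eq, hΦτ, hτQ,
      EndoDecomp.mem_rationalPoints_iff, Point.some.injEq]
    simp only [hadd, mul_pow, ← pow_mul, mul_comm (Fintype.card k)]

section Lattice

lemma mem_decompLattice_iff {N : ℕ} {r : ℕ} {l : Fin r → ℤ} {z : Fin r → ℤ} :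
    z ∈ decompLattice N l ↔ (N : ℤ) ∣ ∑ i, z i * l i := by
  rw [decompLattice, LinearMap.mem_ker, decomp, Fintype.linearCombination_apply,
    ← ZMod.intCast_zmod_eq_zero_iff_dvd]
  simp

lemma index_decompLattice {N : ℕ} {r : ℕ} {l : Fin r → ℤ} (hl : ∃ i, l i = 1) :
    (decompLattice N l).toAddSubgroup.index = N := by
  obtain ⟨i, hi⟩ := hl
  have hsurj : Function.Surjective (decomp N l).toAddMonoidHom := by
    intro a
    obtain ⟨a, rfl⟩ := ZMod.intCast_surjective a
    refine ⟨Pi.single i a, ?_⟩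
    simp [decomp, Fintype.linearCombination_apply_single, hi]
  have h : (decompLattice N l).toAddSubgroup = (decomp N l).toAddMonoidHom.ker := rfl
  rw [h, AddSubgroup.index_ker, AddMonoidHom.range_eq_top.2 hsurj]
  simp

/-- A full set of vectors in a lattice, the determinant of which is the index of the lattice, spans
the lattice. -/
lemma span_eq_of_abs_det_eq_index {n : ℕ} {v : Fin n → Fin n → ℤ} {L : Submodule ℤ (Fin n → ℤ)}
    (hle : Submodule.span ℤ (Set.range v) ≤ L) (hdet : (Matrix.of v).det ≠ 0)
    (hindex : |(Matrix.of v).det| = L.toAddSubgroup.index) :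
    LinearIndependent ℤ v ∧ Submodule.span ℤ (Set.range v) = L := by
  have hli : LinearIndependent ℤ v := Matrix.linearIndependent_rows_of_det_ne_zero hdet
  refine ⟨hli, le_antisymm hle ?_⟩
  set S := Submodule.span ℤ (Set.range v)
  have hS : S.toAddSubgroup.index = L.toAddSubgroup.index := by
    have h := Submodule.natAbs_det_basis_change (Pi.basisFun ℤ (Fin n)) S (Module.Basis.span hli)
    have hv : ((↑) ∘ Module.Basis.span hli : Fin n → Fin n → ℤ) = v := by
      funext i
      simp [Module.Basis.span_apply]
    rw [hv, Pi.basisFun_det] at h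
    zify
    rw [← hindex, ← Int.natCast_natAbs]
    exact_mod_cast h.symm
  have h0 : L.toAddSubgroup.index ≠ 0 := by
    have := abs_pos.2 hdet
    rw [hindex] at this
    exact_mod_cast this.ne'
  have hmul := AddSubgroup.relIndex_mul_index (H := S.toAddSubgroup) (K := L.toAddSubgroup) hle
  rw [hS] at hmul
  exact AddSubgroup.relIndex_eq_one.1 (Nat.eq_of_mul_eq_mul_right (Nat.pos_of_ne_zero h0)
    (by rw [hmul, one_mul]))

end Lattice

end

/-! ### Quadratic relations and the four vectors -/

section

open WeierstrassCurve.Affine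

/-- An element `ψ = c φ + b` of `ℤ[φ]` satisfies its characteristic polynomial. -/
lemma IsQuadratic.affine_mul_self {A : Type*} [AddCommGroup A] {φ ψ : AddMonoid.End A}
    (h : IsQuadratic φ) {b c : ℤ} (hψ : ψ = c • φ + b • (1 : AddMonoid.End A)) :
    ψ * ψ = (c * endTrace φ + 2 * b) • ψ -
      (b ^ 2 + b * c * endTrace φ + c ^ 2 * endNorm φ) • (1 : AddMonoid.End A) := by
  ext P
  have h1 (Q : A) : ψ Q = c • φ Q + b • Q := by rw [hψ]; rfl
  rw [end_sub_apply, end_zsmul_apply, end_zsmul_apply, end_mul_apply, AddMonoid.End.one_apply]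
  simp only [h1, map_add, map_zsmul, h.apply_apply]
  module

lemma det_vectors (b c t n : ℤ) :
    (Matrix.of ![![1, 0, b, c], ![0, 1, -c * n, c * t + b], ![-b, -c, 1, 0],
      ![c * n, -c * t - b, 0, 1]]).det =
      (1 - (b ^ 2 + b * c * t + c ^ 2 * n)) ^ 2 + (c * t + 2 * b) ^ 2 := by
  simp [Matrix.det_succ_row_zero, Fin.sum_univ_succ, Fin.succAbove]
  ring

/-- The coefficients of a relation between `1`, `φ`, `ψ` and `φψ` on the cyclic group `G` form a
vector of the lattice of the eigenvalues. -/
lemma mem_decompLattice_of_eigenvalues {A : Type*} [AddCommGroup A] {G : AddSubgroup A} {N : ℕ}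
    (hN : Nat.card G = N) {g : G} (hg : ∀ x, x ∈ AddSubgroup.zmultiples g)
    {φ ψ : AddMonoid.End A} {lφ lψ lφψ : ℤ} (hlφ : IsEigenvalue G φ lφ)
    (hlψ : IsEigenvalue G ψ lψ) (hlφψ : IsEigenvalue G (φ * ψ) lφψ) {z : Fin 4 → ℤ}
    (hz : z 0 • (g : A) + z 1 • φ g + z 2 • ψ g + z 3 • φ (ψ g) = 0) :
    z ∈ decompLattice N ![1, lφ, lψ, lφψ] := by
  rw [mem_decompLattice_iff, ← hN, ← addOrderOf_eq_card_of_forall_mem_zmultiples hg,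
    addOrderOf_dvd_iff_zsmul_eq_zero]
  ext
  rw [AddSubgroup.coe_zsmul, AddSubgroup.coe_zero, ← hz, ← end_mul_apply, hlφ g g.2, hlψ g g.2,
    hlφψ g g.2]
  simp only [Fin.sum_univ_four, Matrix.cons_val]
  module

end

end EndoDecomp

theorem mainTheorem3 (p : ℕ) [Fact p.Prime]
    {k : Type*} [Field k] [Fintype k] [DecidableEq k] (hk : Fintype.card k = p ^ 2)
    {Ω : Type*} [Field Ω] [DecidableEq Ω] [Algebra k Ω] [IsAlgClosure k Ω] [Algebra (ZMod p) Ω]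
    -- the ordinary curve `E₀` over `𝔽_p`, its endomorphism `φ₀`, and its twist `E'` over `𝔽_{p²}`
    (E₀ : WeierstrassCurve (ZMod p)) [E₀.IsElliptic] (hord : EndoDecomp.IsOrdinary p (E₀.baseChange Ω))
    (φ₀ : AddMonoid.End (EndoDecomp.Pts E₀ Ω)) (hφ₀ : EndoDecomp.IsAlgebraicEnd φ₀)
    (hquad : EndoDecomp.IsQuadratic φ₀)
    (E' : WeierstrassCurve k) [E'.IsElliptic]
    (τ : EndoDecomp.Pts E₀ Ω ≃+ EndoDecomp.Pts E' Ω) (hτ : EndoDecomp.IsQuadraticTwist E₀ E' τ)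
    -- the GLV and GLS endomorphisms of `E'`
    (φ ψ : AddMonoid.End (EndoDecomp.Pts E' Ω))
    (hφ : φ = EndoDecomp.conj τ φ₀) (hψ : ψ = EndoDecomp.conj τ (EndoDecomp.frob Ω E₀))
    (b c : ℤ) (hbc : ψ = c • φ + b • (1 : AddMonoid.End (EndoDecomp.Pts E' Ω)))
    -- the cyclic group `G` of order `N` and the eigenvalues
    (G : AddSubgroup (EndoDecomp.Pts E' Ω)) (hG : G ≤ EndoDecomp.rationalPoints Ω E')
    (hcyc : IsAddCyclic G) (N : ℕ) (hN : Nat.card G = N)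
    (lφ lψ lφψ : ℤ) (hlφ : EndoDecomp.IsEigenvalue G φ lφ)
    (hlψ : EndoDecomp.IsEigenvalue G ψ lψ) (hlφψ : EndoDecomp.IsEigenvalue G (φ * ψ) lφψ)
    (L : Submodule ℤ (Fin 4 → ℤ)) (hL : L = EndoDecomp.decompLattice N ![1, lφ, lψ, lφψ])
    (v : Fin 4 → Fin 4 → ℤ)
    (hv : v = ![
      ![1, 0, b, c],
      ![0, 1, -c * EndoDecomp.endNorm φ, c * EndoDecomp.endTrace φ + b],
      ![-b, -c, 1, 0],
      ![c * EndoDecomp.endNorm φ, -c * EndoDecomp.endTrace φ - b, 0, 1]]) :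
    lψ ^ 2 ≡ -1 [ZMOD N] ∧
    Submodule.span ℤ (Set.range v) ≤ L ∧
    |(Matrix.of v).det| = (Nat.card (EndoDecomp.rationalPoints Ω E') : ℤ) ∧
    (G = EndoDecomp.rationalPoints Ω E' →
      LinearIndependent ℤ v ∧ Submodule.span ℤ (Set.range v) = L) := by
  have hp : p.Prime := Fact.out
  have : IsAlgClosed Ω := IsAlgClosure.isAlgClosed k
  have : CharP Ω p := charP_of_injective_algebraMap' (ZMod p) p
  have : (E₀.baseChange Ω).IsElliptic :=
    inferInstanceAs (E₀.map (algebraMap (ZMod p) Ω)).IsElliptic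
  set π := EndoDecomp.frob Ω E₀
  have hπ : EndoDecomp.IsPowerMap π p := by
    simpa [ZMod.card] using EndoDecomp.isPowerMap_frob (L := Ω) E₀
  have hφq : EndoDecomp.IsQuadratic φ := by
    rw [hφ, EndoDecomp.IsQuadratic, EndoDecomp.minpoly_conj]
    exact hquad
  set t := EndoDecomp.endTrace φ
  set n := EndoDecomp.endNorm φ
  -- the quadratic equation of `π`, and the resulting number of points
  have hππ : π * π = (c * t + 2 * b) • π -
      (b ^ 2 + b * c * t + c ^ 2 * n) • (1 : AddMonoid.End (EndoDecomp.Pts E₀ Ω)) := by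
    apply EndoDecomp.conjHom_injective τ
    have h := hφq.affine_mul_self hbc
    rw [hψ] at h
    rw [map_mul, map_sub, map_zsmul, map_zsmul, map_one]
    exact h
  obtain ⟨hM, hcard⟩ := hπ.card_ker_mul_self_add_one hord hππ
  have hmem (P : EndoDecomp.Pts E' Ω) :
      P ∈ EndoDecomp.rationalPoints Ω E' ↔ (π * π + 1) (τ.symm P) = 0 :=
    hτ.mem_rationalPoints_iff (by rw [hk, pow_two]; exact hπ.mul hπ) P
  have hpoints : Nat.card (EndoDecomp.rationalPoints Ω E') = Nat.card {P // (π * π + 1) P = 0} :=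
    Nat.card_congr (τ.symm.toEquiv.subtypeEquiv hmem)
  have hdet : (Matrix.of v).det = (Nat.card (EndoDecomp.rationalPoints Ω E') : ℤ) := by
    rw [hv, EndoDecomp.det_vectors, hpoints, hcard]
  have hdet0 : (Matrix.of v).det ≠ 0 := by
    rw [hdet, hpoints, hcard, hM]
    have : (1 : ℤ) < p := by exact_mod_cast hp.one_lt
    nlinarith [sq_nonneg (c * t + 2 * b)]
  -- on `G`, the vectors `v i` express that `1 + ψ ^ 2`, `φ (1 + ψ ^ 2)`, `ψ - c φ - b` and
  -- `φ ψ - (c t + b) φ + c n` vanish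
  obtain ⟨g, hg⟩ := hcyc.exists_zsmul_surjective
  replace hg (x : G) : x ∈ AddSubgroup.zmultiples g := hg x
  have hψψ : ψ (ψ g) = -g := by
    have h := (hmem g).1 (hG g.2)
    rw [EndoDecomp.end_add_apply, AddMonoid.End.one_apply, EndoDecomp.end_mul_apply] at h
    have h' := congrArg τ h
    rw [map_add, map_zero, τ.apply_symm_apply] at h'
    rw [hψ, EndoDecomp.conj_apply, EndoDecomp.conj_apply, τ.symm_apply_apply]
    exact eq_neg_of_add_eq_zero_left h'
  have hψφ (Q : EndoDecomp.Pts E' Ω) : ψ Q = c • φ Q + b • Q := by rw [hbc]; rfl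
  have hφφ (Q : EndoDecomp.Pts E' Ω) : φ (φ Q) = t • φ Q - n • Q := hφq.apply_apply Q
  have hφψψ : φ (ψ (ψ g)) = -φ g := by rw [hψψ, map_neg]
  have hle : Submodule.span ℤ (Set.range v) ≤ L := by
    rw [Submodule.span_le, hL]
    rintro _ ⟨i, rfl⟩
    refine EndoDecomp.mem_decompLattice_of_eigenvalues hN hg hlφ hlψ hlφψ ?_
    have h₁ : (g : EndoDecomp.Pts E' Ω) + ψ (ψ g) = 0 := by rw [hψψ, add_neg_cancel]
    have h₂ : φ g + φ (ψ (ψ g)) = 0 := by rw [hφψψ, add_neg_cancel]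
    rw [hv]
    fin_cases i <;> simp only [Fin.zero_eta, Fin.mk_one, Fin.reduceFinMk, Matrix.cons_val]
    · rw [← h₁, hψφ (ψ g)]
      module
    · rw [← h₂, hψφ (ψ g), map_add, map_zsmul, map_zsmul, hφφ]
      module
    · rw [hψφ]
      module
    · rw [hψφ, map_add, map_zsmul, map_zsmul, hφφ]
      module
  refine ⟨?_, hle, by rw [hdet, Nat.abs_cast], fun hGE ↦ ?_⟩
  · refine (Int.modEq_iff_dvd.2 ?_).symm
    rw [← hN, ← addOrderOf_eq_card_of_forall_mem_zmultiples hg, addOrderOf_dvd_iff_zsmul_eq_zero]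
    ext
    have h := hψψ
    rw [hlψ g g.2, map_zsmul, hlψ g g.2] at h
    rw [AddSubgroup.coe_zsmul, AddSubgroup.coe_zero, sub_neg_eq_add, add_smul, one_smul, pow_two,
      mul_smul, h, neg_add_cancel]
  · refine EndoDecomp.span_eq_of_abs_det_eq_index hle hdet0 ?_
    rw [hL, EndoDecomp.index_decompLattice ⟨0, rfl⟩, hdet, Nat.abs_cast, ← hGE, hN]
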